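/- Let $E$ be a real Hilbert space of finite or infinite dimension, $L(E;E)$ the Banach space of its continuous linear endomorphisms, $O(E)=\{\xi\in L(E;E):\xi^*\xi=\xi\xi^*=\mathrm{Id}\}$ its orthogonal group and $G(E)\subset L(E;E)$ the set of orthogonal projections onto closed subspaces of $E$. "Submanifold" means smooth embedded submanifold of a Banach space $V$ (locally carried to a closed complemented subspace by a smooth diffeomorphism of open sets of $V$), and tangent spaces are regarded as subspaces of $V$: $T_x(M)$ is the linear span of the tangent cone of $M$ at $x$. Put $T(M)=\{(x,w): x\in M,\ w\in T_x(M)\}\subset V\times V$. The canonical connection on $O(E)$ is given by $$\theta_\xi(\alpha,\beta)=D\pi_\xi(\beta)(\alpha),\qquad \pi_\xi(\lambda)=\tfrac12(\lambda-\xi\lambda^*\xi),$$ that is, $\nabla W_\xi(\beta)=DW_\xi(\beta)-\theta_\xi(W_\xi,\beta)$ for tangent vector fields $W$; its geodesics are the smooth curves $\gamma$ in $O(E)$ with $\gamma''=\theta_\gamma(\gamma',\gamma')$. Let $H\subset E$ be a closed vector subspace, let $\pi$ be the orthogonal projection onto $H$, and let $\Phi(\xi)=\xi\pi\xi^*$.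 Then $\Phi$ maps $O(E)$ into $G(E)$, and: (1) $O(E)$ is a submanifold of $L(E;E)$, and each fibre $N=\{\xi\in O(E):\Phi(\xi)=p\}$, $p\in G(E)$ (possibly empty), is a submanifold of $L(E;E)$ that is totally geodesic in $O(E)$ for the canonical connection: the connection restricts to $N$, i.e. $(\beta,\theta_\xi(\alpha,\beta))\in T_{(\xi,\alpha)}(T(N))$ for all $\xi\in N$ and $\alpha,\beta\in T_\xi(N)$, and every geodesic $\gamma$ of $O(E)$ with $\gamma(0)\in N$ and $\gamma'(0)\in T_{\gamma(0)}(N)$ satisfies $\gamma(t)\in N$ for all $t$ near $0$. (2) If $E$ is finite dimensional, and $O(E)$ and $G(E)$ carry the Riemannian metrics induced by the Hilbert–Schmidt inner product $\langle\xi,\eta\rangle=\sum_k\langle\xi(x_k),\eta(x_k)\rangle$ ($(x_k)$ an orthonormal basis of $E$), then $\Phi:O(E)\to G(E)$ is a Riemannian submersion: $O(E)$ and $G(E)$ are submanifolds of $L(E;E)$, $\Phi$ is smooth on $O(E)$, and for each $\xi\in O(E)$ the differential $D\Phi_\xi$ maps $T_\xi(O(E))$ onto $T_{\Phi(\xi)}(G(E))$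 and preserves inner products of vectors of $T_\xi(O(E))$ orthogonal to $\ker D\Phi_\xi$. (Surjectivity of $\Phi$ onto $G(E)$, which is in general disconnected, is not part of the claim.) -/

import Mathlib

open scoped ContDiff InnerProductSpace

namespace GrassmannGeometry

noncomputable section

section Submanifolds

variable {V : Type*} [NormedAddCommGroup V] [NormedSpace ℝ V]
variable {W : Type*} [NormedAddCommGroup W] [NormedSpace ℝ W]

/-- `M` is a (smooth, embedded, split) submanifold of the normed space `V`: around each of its
points there is a smooth local diffeomorphism of `V` carrying `M` to a closed complemented linear
subspace of `V`. The dimension may vary from point to point. -/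
def IsSubmanifold (M : Set V) : Prop :=
  ∀ x ∈ M, ∃ (T : Submodule ℝ V) (φ : OpenPartialHomeomorph V V),
    T.ClosedComplemented ∧ x ∈ φ.source ∧
    ContDiffOn ℝ ∞ φ φ.source ∧ ContDiffOn ℝ ∞ φ.symm φ.target ∧
    ∀ y ∈ φ.source, y ∈ M ↔ φ y ∈ T

/-- The tangent space of a subset `M` of `V` at `x`, a vector subspace of `V`: the span of
the tangent cone, i.e. of the limits of `c n • d n` with `d n → 0` and `x + d n ∈ M`. -/
def tangentSpaceAt (M : Set V) (x : V) : Submodule ℝ V :=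
  Submodule.span ℝ (tangentConeAt ℝ M x)

/-- The total space `T(M) ⊆ V × V` of the tangent bundle of `M ⊆ V`. -/
def tangentBundleSet (M : Set V) : Set (V × V) :=
  {p | p.1 ∈ M ∧ p.2 ∈ tangentSpaceAt M p.1}

/-- A connection in the tangent bundle of `M ⊆ V` is given by its second fundamental form
`θ x w u` (`w` the vector being differentiated, `u` the direction), so that
`∇ W x u = D W x u - θ x (W x) u`. Thus `γ`, defined on an open set `J ⊆ ℝ`, is a geodesic of
`M` if it is smooth, `M`-valued and `γ'' = θ_γ (γ', γ')`. -/
def IsGeodesicOn (θ : V → V → V → V) (M : Set V) (γ : ℝ → V) (J : Set ℝ) : Prop :=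
  IsOpen J ∧ Set.MapsTo γ J M ∧ ContDiffOn ℝ ∞ γ J ∧
    ∀ t ∈ J, deriv (deriv γ) t = θ (γ t) (deriv γ t) (deriv γ t)

/-- `N` is a totally geodesic submanifold of `M`, for the connection `θ` of `M`: both are
submanifolds, `N ⊆ M`, the connection `θ` of `M` restricts to a connection of `N` (equivalently,
covariant derivatives of tangent fields of `N` in directions tangent to `N` are tangent to `N`),
and every geodesic of `M` issuing from a point of `N` tangentially to `N` stays in `N` for small
times. -/
structure IsTotallyGeodesic (θ : V → V → V → V) (M N : Set V) : Prop where
  ambient : IsSubmanifold M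
  submanifold : IsSubmanifold N
  subset : N ⊆ M
  restricts : ∀ x ∈ N, ∀ w ∈ tangentSpaceAt N x, ∀ u ∈ tangentSpaceAt N x,
    (u, θ x w u) ∈ tangentSpaceAt (tangentBundleSet N) (x, w)
  geodesic : ∀ (γ : ℝ → V) (J : Set ℝ), 0 ∈ J → IsGeodesicOn θ M γ J → γ 0 ∈ N →
    deriv γ 0 ∈ tangentSpaceAt N (γ 0) → ∀ᶠ t in nhds (0 : ℝ), γ t ∈ N

/-- `f` restricts to a Riemannian submersion from `M ⊆ V` to `N ⊆ W`, where the metrics of `M`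
and `N` are the restrictions to the tangent spaces of the inner products `gV` on `V` and `gW`
on `W`: `f` is a smooth map between submanifolds, at each point its differential is onto the
tangent space of `N`, and preserves inner products of horizontal vectors, i.e. of tangent
vectors that are orthogonal to the kernel of the differential.
(The within-derivative of `f` is uniquely determined on the tangent spaces of `M`.) -/
structure IsRiemannianSubmersion (gV : V → V → ℝ) (gW : W → W → ℝ)
    (M : Set V) (N : Set W) (f : V → W) : Prop where
  source : IsSubmanifold M
  target : IsSubmanifold N
  mapsTo : Set.MapsTo f M N
  smooth : ContDiffOn ℝ ∞ f M
  surjective : ∀ x ∈ M, (tangentSpaceAt M x).map (fderivWithin ℝ f M x : V →ₗ[ℝ] W) =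
    tangentSpaceAt N (f x)
  isometric : ∀ x ∈ M, ∀ u ∈ tangentSpaceAt M x, ∀ v ∈ tangentSpaceAt M x,
    (∀ w ∈ tangentSpaceAt M x, fderivWithin ℝ f M x w = 0 → gV u w = 0) →
    (∀ w ∈ tangentSpaceAt M x, fderivWithin ℝ f M x w = 0 → gV v w = 0) →
    gW (fderivWithin ℝ f M x u) (fderivWithin ℝ f M x v) = gV u v

end Submanifolds

section Hilbert

variable (E : Type*) [NormedAddCommGroup E] [InnerProductSpace ℝ E]

/-- The Grassmann manifold `G(E)`: the orthogonal projections onto the closed subspaces of `E`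
(in a Hilbert space, those are the subspaces that have an orthogonal projection). -/
def grassmannian : Set (E →L[ℝ] E) :=
  {p | ∃ (K : Submodule ℝ E) (_ : K.HasOrthogonalProjection), p = K.starProjection}

variable [CompleteSpace E]

/-- The orthogonal group `O(E)`: the `ξ` with `ξ* ∘ ξ = ξ ∘ ξ* = Id`. -/
def orthogonalGroup : Set (E →L[ℝ] E) :=
  (unitary (E →L[ℝ] E) : Set (E →L[ℝ] E))

variable {E}

/-- The projections `L(E;E) → T_ξ O(E)`, `μ ↦ (μ - ξ ∘ μ* ∘ ξ) / 2`. -/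
def tangentProj (ξ μ : E →L[ℝ] E) : E →L[ℝ] E :=
  (1 / 2 : ℝ) • (μ - ξ ∘L (ContinuousLinearMap.adjoint μ) ∘L ξ)

/-- The canonical connection on `O(E)`: `θ_ξ(α, β)` is the derivative of
`ξ ↦ tangentProj ξ α` at `ξ` in the direction `β`. -/
def canonicalConnection (ξ α β : E →L[ℝ] E) : E →L[ℝ] E :=
  fderiv ℝ (fun ζ : E →L[ℝ] E => tangentProj ζ α) ξ β

/-- The map `Φ : ξ ↦ ξ ∘ π ∘ ξ*`, where `π` is the orthogonal projection onto `H`. -/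
def Phi (H : Submodule ℝ E) [H.HasOrthogonalProjection] (ξ : E →L[ℝ] E) : E →L[ℝ] E :=
  ξ ∘L H.starProjection ∘L (ContinuousLinearMap.adjoint ξ)

/-- The fibre over `p` of `Φ : O(E) → G(E)`. -/
def PhiFibre (H : Submodule ℝ E) [H.HasOrthogonalProjection] (p : E →L[ℝ] E) :
    Set (E →L[ℝ] E) :=
  {ξ | ξ ∈ orthogonalGroup E ∧ Phi H ξ = p}

/-- The Hilbert–Schmidt inner product on `L(E;E)`, for finite dimensional `E`. -/
def hsInner [FiniteDimensional ℝ E] (ξ η : E →L[ℝ] E) : ℝ :=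
  ∑ k, ⟪ξ (stdOrthonormalBasis ℝ E k), η (stdOrthonormalBasis ℝ E k)⟫_ℝ

end Hilbert

end

end GrassmannGeometry

open GrassmannGeometry

namespace GrassmannGeometry

open Filter Topology

/-! ### Tangent vectors from curves and from equations -/

section TangentSpaces

variable {V : Type*} [NormedAddCommGroup V] [NormedSpace ℝ V]
variable {W : Type*} [NormedAddCommGroup W] [NormedSpace ℝ W]

/-! Most of the argument takes place in a real Banach star algebra, later specialised to `L(E;E)`. A
fibre of `Φ` through `x` is the coset of `x` under the unitaries commuting with the projection `p`,
equivalently with the reflection `s = 2p - 1`. The Cayley transform turns unitarity into skewness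
and commutation with `s` into the linear condition `s a s = a`, so composed with `y ↦ x* y` it is a
submanifold chart; `p = 1` gives `O(E)`. For `G(E)` the map `y ↦ s (2y - 1)` moves the base point to
`1`, and the linear condition becomes `s a s = -a` (`isSubmanifold_conjFibre`,
`isSubmanifold_setOf_isStarProjection`).

Tangent spaces are bounded above by differentiating the defining equations and filled by curves
built from exponentials. Along a geodesic `γ* γ'` is constant; if it commutes with `p` at time `0`,
then `γ p γ*` has zero derivative, so `γ` stays in the fibre.

For the submersion, `DΦ_ξ(ξ b) = ξ [b, π] ξ*`. Horizontality of `ξ a` forces `a` to anticommute with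
`s = 2π - 1`, whence `[a, π] = a s`. Thus `DΦ_ξ` acts on horizontal vectors by orthogonal factors on
the left and right, which preserve the Hilbert–Schmidt product. -/

theorem mem_tangentSpaceAt_of_hasDerivAt {M : Set V} {γ : ℝ → V} {v : V}
    (h : HasDerivAt γ v 0) (hM : ∀ t, γ t ∈ M) : v ∈ tangentSpaceAt M (γ 0) := by
  refine Submodule.subset_span ?_
  refine mem_tangentConeAt_of_seq (𝓝[≠] (0 : ℝ)) (fun t => t⁻¹) (fun t => γ t - γ 0) ?_ ?_ ?_
  · have h1 : Tendsto γ (𝓝[≠] 0) (𝓝 (γ 0)) := h.continuousAt.tendsto.mono_left nhdsWithin_le_nhds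
    simpa using h1.sub_const (γ 0)
  · simp [hM]
  · simpa using hasDerivAt_iff_tendsto_slope_zero.1 h

theorem eqOn_tangentSpaceAt {M : Set V} {x v : V} {f : V → W} {f₁ f₂ : V →L[ℝ] W}
    (h₁ : HasFDerivWithinAt f f₁ M x) (h₂ : HasFDerivWithinAt f f₂ M x)
    (hv : v ∈ tangentSpaceAt M x) : f₁ v = f₂ v := by
  have h : tangentSpaceAt M x ≤ (f₁ - f₂ : V →L[ℝ] W).ker := by
    refine Submodule.span_le.2 fun w hw => ?_
    simpa [sub_eq_zero] using h₁.unique_on h₂ hw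
  simpa [sub_eq_zero] using h hv

theorem apply_eq_zero_of_mem_tangentSpaceAt {M : Set V} {x v : V} {f : V → W} {f' : V →L[ℝ] W}
    {c : W} (h : HasFDerivAt f f' x) (hx : x ∈ M) (hc : ∀ y ∈ M, f y = c)
    (hv : v ∈ tangentSpaceAt M x) : f' v = 0 :=
  eqOn_tangentSpaceAt h.hasFDerivWithinAt
    ((hasFDerivWithinAt_const c x M).congr hc (hc x hx)) hv

end TangentSpaces

/-! ### The Cayley transform as a linearising chart -/

section CayleyTransform

theorem ringInverse_ringInverse {R : Type*} [Ring R] {a : R} (ha : IsUnit a) :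
    Ring.inverse (Ring.inverse a) = a := by
  obtain ⟨u, rfl⟩ := ha
  rw [Ring.inverse_unit, Ring.inverse_unit, inv_inv]

variable {A : Type*} [NormedRing A] [NormedAlgebra ℝ A]

/-- The Cayley transform `g ↦ (g - 1) (g + 1)⁻¹`, as a map of the set of `g` such that `g + 1` is
invertible onto the set of `a` such that `1 - a` is invertible. -/
noncomputable def cayley (g : A) : A := 1 - (2 : ℝ) • Ring.inverse (g + 1)

/-- The inverse `a ↦ (1 + a) (1 - a)⁻¹` of the Cayley transform. -/
noncomputable def cayleyInv (a : A) : A := (2 : ℝ) • Ring.inverse (1 - a) - 1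

theorem ringInverse_smul {c : ℝ} (hc : c ≠ 0) (a : A) :
    Ring.inverse (c • a) = c⁻¹ • Ring.inverse a := by
  by_cases ha : IsUnit a
  · obtain ⟨u, rfl⟩ := ha
    have h : c • (u : A) = ((Units.mk0 c hc • u : Aˣ) : A) := rfl
    rw [h, Ring.inverse_unit, Ring.inverse_unit]
    simp [Units.smul_def]
  · have h : ¬ IsUnit (c • a) := fun h => ha <| by
      have := h.smul (Units.mk0 c hc)⁻¹
      simpa [Units.smul_def, smul_smul, hc] using this
    rw [Ring.inverse_non_unit _ ha, Ring.inverse_non_unit _ h, smul_zero]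

theorem isUnit_smul_ringInverse {c : ℝ} (hc : c ≠ 0) {a : A} (ha : IsUnit a) :
    IsUnit (c • Ring.inverse a) := by
  obtain ⟨u, rfl⟩ := ha
  exact ⟨Units.mk0 c hc • u⁻¹, by simp [Units.smul_def]⟩

theorem isUnit_two_smul_one : IsUnit ((1 : A) + 1) := by
  have h := (isUnit_one (M := A)).smul (Units.mk0 (2 : ℝ) two_ne_zero)
  simpa [Units.smul_def, two_smul] using h

theorem contDiffOn_ringInverse [CompleteSpace A] :
    ContDiffOn ℝ ∞ (Ring.inverse : A → A) {a | IsUnit a} := by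
  rintro _ ⟨u, rfl⟩
  exact (contDiffAt_ringInverse ℝ u).contDiffWithinAt

theorem contDiffOn_cayley [CompleteSpace A] :
    ContDiffOn ℝ ∞ (cayley : A → A) {g | IsUnit (g + 1)} :=
  contDiffOn_const.sub <| (contDiffOn_ringInverse.comp
    (g := Ring.inverse) (f := fun g : A => g + 1)
    (contDiffOn_id.add contDiffOn_const) fun _ h => h).const_smul (2 : ℝ)

theorem contDiffOn_cayleyInv [CompleteSpace A] :
    ContDiffOn ℝ ∞ (cayleyInv : A → A) {a | IsUnit (1 - a)} :=
  ContDiffOn.sub ((contDiffOn_ringInverse.comp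
    (g := Ring.inverse) (f := fun a : A => 1 - a)
    (contDiffOn_const.sub contDiffOn_id) fun _ h => h).const_smul (2 : ℝ)) contDiffOn_const

/-- The Cayley transform as a partial homeomorphism. -/
noncomputable def cayleyHomeomorph [CompleteSpace A] : OpenPartialHomeomorph A A where
  toFun := cayley
  invFun := cayleyInv
  source := {g | IsUnit (g + 1)}
  target := {a | IsUnit (1 - a)}
  map_source' g hg := by
    simpa [cayley] using isUnit_smul_ringInverse two_ne_zero hg
  map_target' a ha := by
    simpa [cayleyInv] using isUnit_smul_ringInverse two_ne_zero ha
  left_inv' g hg := by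
    simp only [cayley, cayleyInv, sub_sub_cancel, ringInverse_smul (two_ne_zero' ℝ),
      ringInverse_ringInverse hg, smul_smul]
    simp
  right_inv' a ha := by
    simp only [cayley, cayleyInv, sub_add_cancel, ringInverse_smul (two_ne_zero' ℝ),
      ringInverse_ringInverse ha, smul_smul]
    simp
  open_source := Units.isOpen.preimage (by fun_prop : Continuous fun g : A => g + 1)
  open_target := Units.isOpen.preimage (by fun_prop : Continuous fun g : A => 1 - g)
  continuousOn_toFun := contDiffOn_cayley.continuousOn
  continuousOn_invFun := contDiffOn_cayleyInv.continuousOn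

/-- The map `e` normalises the base point to `1`, which lies in the Cayley domain because `1 + 1` is
invertible; `M` then only has to be linearised near `1`. -/
theorem isSubmanifold_of_cayley [CompleteSpace A] {M : Set A}
    (h : ∀ x ∈ M, ∃ (T : Submodule ℝ A) (e : A ≃ₜ A), T.ClosedComplemented ∧ ContDiff ℝ ∞ e ∧
      ContDiff ℝ ∞ e.symm ∧ e x = 1 ∧ ∀ y, IsUnit (e y + 1) → (y ∈ M ↔ cayley (e y) ∈ T)) :
    IsSubmanifold M := by
  intro x hx
  obtain ⟨T, e, hT, he, he', hex, hM⟩ := h x hx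
  refine ⟨T, e.toOpenPartialHomeomorph.trans cayleyHomeomorph, hT, ?_, ?_, ?_, ?_⟩
  · simp [cayleyHomeomorph, hex, isUnit_two_smul_one]
  · exact contDiffOn_cayley.comp he.contDiffOn fun y hy => by simpa [cayleyHomeomorph] using hy
  · exact he'.comp_contDiffOn
      (contDiffOn_cayleyInv.mono fun y hy => by simpa [cayleyHomeomorph] using hy)
  · intro y hy
    exact hM y (by simpa [cayleyHomeomorph] using hy)

theorem one_sub_two_smul_eq_neg_iff {a b : A} :
    1 - (2 : ℝ) • a = -(1 - (2 : ℝ) • b) ↔ a + b = 1 := by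
  have h : 1 - (2 : ℝ) • a + (1 - (2 : ℝ) • b) = (2 : ℝ) • (1 - (a + b)) := by
    simp only [two_smul]; abel
  rw [eq_neg_iff_add_eq_zero, h, smul_eq_zero_iff_right (two_ne_zero' ℝ), sub_eq_zero, eq_comm]

section Star

variable [StarRing A] [StarModule ℝ A]

theorem star_cayley_eq_neg_iff {g : A} (hg : IsUnit (g + 1)) :
    star (cayley g) = -cayley g ↔ g ∈ unitary A := by
  set r := Ring.inverse (g + 1) with hr
  have h1 : r * (g + 1) = 1 := Ring.inverse_mul_cancel _ hg
  have h2 : (g + 1) * r = 1 := Ring.mul_inverse_cancel _ hg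
  have h3 : star (g + 1) * star r = 1 := by rw [← star_mul, h1, star_one]
  have h4 : star r * star (g + 1) = 1 := by rw [← star_mul, h2, star_one]
  have key : star (cayley g) = -cayley g ↔ star r + r = 1 := by
    have e1 : star (cayley g) = 1 - (2 : ℝ) • star r := by simp [cayley, hr]
    have e2 : cayley g = 1 - (2 : ℝ) • r := rfl
    rw [e1, e2, one_sub_two_smul_eq_neg_iff]
  rw [key, Unitary.mem_iff]
  constructor
  · intro h
    constructor
    · have e : star (g + 1) * (star r + r) * (g + 1) =
          star (g + 1) * star r * (g + 1) + star (g + 1) * (r * (g + 1)) := by noncomm_ring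
      rw [h, mul_one, h3, h1, mul_one, one_mul, star_add, star_one] at e
      rw [← sub_eq_zero] at e ⊢
      rw [← e]; noncomm_ring
    -- In infinite dimension `g* g = 1` does not give `g g* = 1`, so the computation is repeated
    -- with the factors on the other sides.
    · have e : (g + 1) * (star r + r) * star (g + 1) =
          (g + 1) * (star r * star (g + 1)) + (g + 1) * r * star (g + 1) := by noncomm_ring
      rw [h, mul_one, h4, h2, mul_one, one_mul, star_add, star_one] at e
      rw [← sub_eq_zero] at e ⊢
      rw [← e]; noncomm_ring
  · rintro ⟨h, -⟩
    have e : star (g + 1) + (g + 1) = star (g + 1) * (g + 1) := by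
      rw [star_add, star_one, mul_add, add_mul, h]; noncomm_ring
    calc star r + r = star r * (star (g + 1) + (g + 1)) * r := by
          rw [mul_add, add_mul, h4, one_mul, mul_assoc, h2, mul_one, add_comm]
      _ = 1 := by rw [e, ← mul_assoc, h4, one_mul, h2]

end Star

theorem conj_cayley_eq_self_iff {s g : A} (hs : s * s = 1) (hg : IsUnit (g + 1)) :
    s * cayley g * s = cayley g ↔ s * g * s = g := by
  set r := Ring.inverse (g + 1) with hr
  have h1 : r * (g + 1) = 1 := Ring.inverse_mul_cancel _ hg
  have h2 : (g + 1) * r = 1 := Ring.mul_inverse_cancel _ hg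
  have key : s * cayley g * s = cayley g ↔ s * r * s = r := by
    have e1 : s * cayley g * s = 1 - (2 : ℝ) • (s * r * s) := by
      simp [cayley, hr, mul_sub, sub_mul, hs]
    have e2 : cayley g = 1 - (2 : ℝ) • r := rfl
    rw [e1, e2, sub_right_inj]
    exact (smul_right_injective A (two_ne_zero' ℝ)).eq_iff
  rw [key]
  have f1 : s * r * s = r ↔ s * r = r * s := by
    constructor
    · intro h; nth_rw 2 [← h]; rw [mul_assoc, hs, mul_one]
    · intro h; rw [h, mul_assoc, hs, mul_one]
  have f2 : s * g * s = g ↔ s * g = g * s := by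
    constructor
    · intro h; nth_rw 2 [← h]; rw [mul_assoc, hs, mul_one]
    · intro h; rw [h, mul_assoc, hs, mul_one]
  rw [f1, f2]
  constructor
  · intro h
    have : s * (g + 1) = (g + 1) * s := by
      calc s * (g + 1) = (g + 1) * (r * s) * (g + 1) := by rw [← mul_assoc, h2, one_mul]
        _ = (g + 1) * s := by rw [← h, mul_assoc, mul_assoc s, h1, mul_one]
    simpa [mul_add, add_mul] using this
  · intro h
    have : s * (g + 1) = (g + 1) * s := by rw [mul_add, add_mul, h, mul_one, one_mul]
    calc s * r = r * ((g + 1) * s) * r := by rw [← mul_assoc, h1, one_mul]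
      _ = r * s := by rw [← this, mul_assoc, mul_assoc s, h2, mul_one]

/-- Conceptually, inverting `g` negates its Cayley transform, so the condition says that conjugation
by `s` inverts `g`. With `r = (g + 1)⁻¹` it reads `s r + r s = s`; multiplying by `g + 1` on both
sides leaves `g s g = s`. -/
theorem conj_cayley_eq_neg_iff {s g : A} (hs : s * s = 1) (hg : IsUnit (g + 1)) :
    s * cayley g * s = -cayley g ↔ g * s * g = s := by
  set r := Ring.inverse (g + 1) with hr
  have h1 : r * (g + 1) = 1 := Ring.inverse_mul_cancel _ hg
  have h2 : (g + 1) * r = 1 := Ring.mul_inverse_cancel _ hg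
  have key : s * cayley g * s = -cayley g ↔ s * r * s + r = 1 := by
    have e1 : s * cayley g * s = 1 - (2 : ℝ) • (s * r * s) := by
      simp [cayley, hr, mul_sub, sub_mul, hs]
    have e2 : cayley g = 1 - (2 : ℝ) • r := rfl
    rw [e1, e2, one_sub_two_smul_eq_neg_iff]
  have key2 : s * r * s + r = 1 ↔ s * r + r * s = s := by
    constructor
    · intro h
      have := congr_arg (· * s) h
      simpa [add_mul, mul_assoc, hs] using this
    · intro h
      have := congr_arg (· * s) h
      simpa [add_mul, mul_assoc, hs] using this
  rw [key, key2]
  constructor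
  · intro h
    have e : (g + 1) * (s * r + r * s) * (g + 1) =
        (g + 1) * s * (r * (g + 1)) + (g + 1) * r * s * (g + 1) := by
      noncomm_ring
    rw [h, h1, h2, mul_one, one_mul] at e
    rw [← sub_eq_zero] at e ⊢
    rw [← e]; noncomm_ring
  · intro h
    have e : (g + 1) * s + s * (g + 1) = (g + 1) * s * (g + 1) := by
      rw [← sub_eq_zero] at h ⊢
      rw [← neg_eq_zero, ← h]; noncomm_ring
    calc s * r + r * s = r * (g + 1) * s * r + r * s * ((g + 1) * r) := by
          rw [h1, h2, one_mul, mul_one]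
      _ = r * ((g + 1) * s + s * (g + 1)) * r := by simp only [mul_add, add_mul, mul_assoc]
      _ = s := by rw [e, mul_assoc, mul_assoc, h2, mul_one, ← mul_assoc, h1, one_mul]

end CayleyTransform

/-! ### The model subspaces of the charts -/

section SkewElements

variable {A : Type*} [NormedRing A] [NormedAlgebra ℝ A] [StarRing A] [StarModule ℝ A]

/-- The space of skew-adjoint `a` such that `s * a * s = c • a`. -/
def skewConj (s : A) (c : ℝ) : Submodule ℝ A where
  carrier := {a | star a = -a ∧ s * a * s = c • a}
  zero_mem' := by simp
  add_mem' := by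
    rintro a b ⟨h1, h2⟩ ⟨h3, h4⟩
    refine ⟨?_, ?_⟩
    · rw [star_add, h1, h3, neg_add]
    · rw [mul_add, add_mul, h2, h4, smul_add]
  smul_mem' := by
    rintro t a ⟨h1, h2⟩
    refine ⟨?_, ?_⟩
    · rw [star_smul, h1, star_trivial, smul_neg]
    · rw [mul_smul_comm, smul_mul_assoc, h2, smul_comm]

theorem mem_skewConj {s a : A} {c : ℝ} :
    a ∈ skewConj s c ↔ star a = -a ∧ s * a * s = c • a := Iff.rfl

/-- The projection is `L ∘ K`: `K` takes the skew part and `L` averages over conjugation by `s` with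
sign `c`. Since `s` is self-adjoint, `L` preserves skewness. -/
theorem closedComplemented_skewConj [ContinuousStar A] {s : A} {c : ℝ} (hs : s * s = 1)
    (hs' : star s = s) (hc : c * c = 1) : (skewConj s c).ClosedComplemented := by
  let S : A →L[ℝ] A := starL' ℝ (A := A)
  let K : A →L[ℝ] A := (1 / 2 : ℝ) • (ContinuousLinearMap.id ℝ A - S)
  let L : A →L[ℝ] A := (1 / 2 : ℝ) • (ContinuousLinearMap.id ℝ A +
    c • ((ContinuousLinearMap.mul ℝ A s) ∘L (ContinuousLinearMap.mul ℝ A).flip s))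
  have hK : ∀ a, K a = (1 / 2 : ℝ) • (a - star a) := fun a => rfl
  have hL : ∀ a, L a = (1 / 2 : ℝ) • (a + c • (s * (a * s))) := fun a => rfl
  have hmem : ∀ a, L (K a) ∈ skewConj s c := by
    intro a
    have h1 : star (K a) = -K a := by
      rw [hK, star_smul, star_sub, star_star, star_trivial, ← smul_neg, neg_sub]
    have h2 : ∀ b : A, s * (s * (b * s) * s) = b := fun b => by
      simp only [mul_assoc, hs, mul_one]
      rw [← mul_assoc, hs, one_mul]
    refine ⟨?_, ?_⟩
    · rw [hL, star_smul, star_add, star_smul, star_mul, star_mul, hs', h1, star_trivial,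
        star_trivial, ← smul_neg, neg_add, ← smul_neg]
      simp [mul_assoc]
    · rw [hL, mul_assoc, smul_mul_assoc, mul_smul_comm, smul_comm c, add_mul, mul_add,
        smul_mul_assoc, mul_smul_comm, h2, smul_add c, smul_smul, hc, one_smul, add_comm]
  refine ⟨(L ∘L K).codRestrict _ hmem, ?_⟩
  rintro ⟨a, ha1, ha2⟩
  apply Subtype.ext
  change L (K a) = a
  have hKa : K a = a := by rw [hK, ha1, sub_neg_eq_add, ← two_smul ℝ a, smul_smul]; norm_num
  rw [hKa, hL, ← mul_assoc, ha2, smul_smul, hc, one_smul, ← two_smul ℝ a, smul_smul]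
  norm_num

end SkewElements

/-! ### Projections, reflections and exponentials -/

section Algebra

variable {A : Type*} [NormedRing A]

theorem reflection_mul_self {p : A} (hp : p * p = p) : (p + p - 1) * (p + p - 1) = 1 := by
  have h : (p + p - 1) * (p + p - 1) = 4 • (p * p - p) + 1 := by noncomm_ring
  rw [h, hp, sub_self, smul_zero, zero_add]

variable [NormedAlgebra ℝ A]

theorem add_self_inj {a b : A} : a + a = b + b ↔ a = b := by
  rw [← two_smul ℝ a, ← two_smul ℝ b]
  exact (smul_right_injective A (two_ne_zero' ℝ)).eq_iff

theorem reflection_conj_eq_self_iff {p g : A} (hp : p * p = p) :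
    (p + p - 1) * g * (p + p - 1) = g ↔ g * p = p * g := by
  have hs := reflection_mul_self hp
  set s := p + p - 1 with hsp
  have h1 : s * g * s = g ↔ g * s = s * g := by
    constructor
    · intro h
      nth_rw 1 [← h]
      rw [mul_assoc, hs, mul_one]
    · intro h
      rw [← h, mul_assoc, hs, mul_one]
  rw [h1, hsp, mul_sub, sub_mul, mul_add, add_mul, mul_one, one_mul, sub_left_inj, add_self_inj]

/-- Left multiplication by an invertible element, as a homeomorphism. -/
def mulLeftHomeomorph (a b : A) (hab : a * b = 1) (hba : b * a = 1) : A ≃ₜ A where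
  toFun y := a * y
  invFun y := b * y
  left_inv y := by
    simp only
    rw [← mul_assoc, hba, one_mul]
  right_inv y := by
    simp only
    rw [← mul_assoc, hab, one_mul]
  continuous_toFun := by fun_prop
  continuous_invFun := by fun_prop

/-- The affine homeomorphism `y ↦ s * (2 * y - 1)`, for an involution `s`. -/
noncomputable def reflectionHomeomorph (s : A) (hs : s * s = 1) : A ≃ₜ A where
  toFun y := s * (y + y - 1)
  invFun z := (1 / 2 : ℝ) • (s * z + 1)
  left_inv y := by
    simp only
    rw [← mul_assoc, hs, one_mul, sub_add_cancel, ← two_smul ℝ y, smul_smul]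
    norm_num
  right_inv z := by
    simp only
    rw [← add_smul]
    norm_num
    rw [← mul_assoc, hs, one_mul]
  continuous_toFun := by fun_prop
  continuous_invFun := by fun_prop

theorem exp_smul_commute {p b : A} (h : b * p = p * b) (t : ℝ) :
    NormedSpace.exp (t • b) * p = p * NormedSpace.exp (t • b) := by
  have h1 : Commute (t • b) p := (show Commute b p from h).smul_left t
  exact h1.exp_left.eq

theorem hasDerivAt_exp_smul_zero [CompleteSpace A] (b : A) :
    HasDerivAt (fun t : ℝ => NormedSpace.exp (t • b)) b 0 := by
  simpa using hasDerivAt_exp_smul_const (𝕂 := ℝ) b 0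

end Algebra

/-! ### Fibres and projections in a star algebra: charts and tangent spaces -/

section StarAlgebra

variable {A : Type*} [NormedRing A] [StarRing A]

/-- The fibre over `q` of the map `x ↦ x * p * star x` on the unitary group. -/
def conjFibre (p q : A) : Set A := {x | x ∈ unitary A ∧ x * (p * star x) = q}

/-- This makes the unitary group itself a fibre, so its manifold structure and tangent spaces come
as special cases. -/
theorem conjFibre_one : conjFibre (1 : A) 1 = unitary A := by
  ext x
  simp only [conjFibre, Set.mem_ofPred_eq, one_mul, SetLike.mem_coe]
  exact ⟨fun h => h.1, fun h => ⟨h, Unitary.mul_star_self_of_mem h⟩⟩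

theorem mul_eq_mul_of_mem_conjFibre {p q x : A} (hx : x ∈ conjFibre p q) : x * p = q * x := by
  rw [← hx.2, mul_assoc, mul_assoc, Unitary.star_mul_self_of_mem hx.1, mul_one]

theorem mul_mem_conjFibre {p q x g : A} (hx : x ∈ conjFibre p q) (hg : g ∈ unitary A)
    (hgp : g * p = p * g) : x * g ∈ conjFibre p q := by
  refine ⟨mul_mem hx.1 hg, ?_⟩
  have h : g * (p * star g) = p := by
    rw [← mul_assoc, hgp, mul_assoc, Unitary.mul_star_self_of_mem hg, mul_one]
  rw [star_mul, mul_assoc, ← mul_assoc p, ← mul_assoc g, h, hx.2]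

/-- The fibre is a left coset of the unitary centraliser of `p`. -/
theorem mem_conjFibre_iff {p q x y : A} (hx : x ∈ conjFibre p q) :
    y ∈ conjFibre p q ↔ star x * y ∈ unitary A ∧ star x * y * p = p * (star x * y) := by
  constructor
  · intro hy
    have hg := mul_mem (Unitary.star_mem hx.1) hy.1
    refine ⟨hg, ?_⟩
    rw [mul_assoc, mul_eq_mul_of_mem_conjFibre hy]
    have h : star x * q = p * star x := by
      rw [← hx.2, ← mul_assoc, Unitary.star_mul_self_of_mem hx.1, one_mul]
    rw [← mul_assoc, h, mul_assoc]
  · rintro ⟨h1, h2⟩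
    have := mul_mem_conjFibre hx h1 h2
    rwa [← mul_assoc, Unitary.mul_star_self_of_mem hx.1, one_mul] at this

variable [NormedAlgebra ℝ A] [StarModule ℝ A] [ContinuousStar A] [CompleteSpace A]

theorem isSubmanifold_conjFibre {p : A} (hp : IsStarProjection p) (q : A) :
    IsSubmanifold (conjFibre p q) := by
  have hpp : p * p = p := hp.isIdempotentElem
  have hps : star p = p := hp.isSelfAdjoint
  refine isSubmanifold_of_cayley fun x hx => ?_
  have h1 := Unitary.star_mul_self_of_mem hx.1
  have h2 := Unitary.mul_star_self_of_mem hx.1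
  refine ⟨skewConj (p + p - 1) 1, mulLeftHomeomorph (star x) x h1 h2,
    closedComplemented_skewConj (reflection_mul_self hpp) (by simp [hps]) (one_mul 1),
    contDiff_const.mul contDiff_id, contDiff_const.mul contDiff_id, h1, fun y hy => ?_⟩
  rw [mem_conjFibre_iff hx, mem_skewConj, star_cayley_eq_neg_iff hy, one_smul,
    conj_cayley_eq_self_iff (reflection_mul_self hpp) hy, reflection_conj_eq_self_iff hpp]
  rfl

theorem isSubmanifold_setOf_isStarProjection :
    IsSubmanifold {p : A | IsStarProjection p} := by
  refine isSubmanifold_of_cayley fun p hp => ?_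
  have hpp : p * p = p := hp.isIdempotentElem
  have hps : star p = p := hp.isSelfAdjoint
  have hs := reflection_mul_self hpp
  have hss : star (p + p - 1) = p + p - 1 := by simp [hps]
  refine ⟨skewConj (p + p - 1) (-1), reflectionHomeomorph _ hs,
    closedComplemented_skewConj hs hss (by norm_num),
    contDiff_const.mul ((contDiff_id.add contDiff_id).sub contDiff_const),
    ((contDiff_const.mul contDiff_id).add contDiff_const).const_smul (1 / 2 : ℝ), hs,
    fun y hy => ?_⟩
  rw [mem_skewConj, star_cayley_eq_neg_iff hy, neg_one_smul, conj_cayley_eq_neg_iff hs hy]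
  change IsStarProjection y ↔ (p + p - 1) * (y + y - 1) ∈ unitary A ∧
    (p + p - 1) * (y + y - 1) * (p + p - 1) * ((p + p - 1) * (y + y - 1)) = p + p - 1
  set s := p + p - 1
  have e1 : s * (y + y - 1) * s * (s * (y + y - 1)) = s * ((y + y - 1) * (y + y - 1)) := by
    rw [mul_assoc _ s, ← mul_assoc s s, hs, one_mul, mul_assoc]
  rw [e1]
  constructor
  · intro hy
    have h1 := reflection_mul_self hy.isIdempotentElem.eq
    have h2 : star (y + y - 1) = y + y - 1 := by simp [hy.isSelfAdjoint.star_eq]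
    rw [h1, mul_one]
    refine ⟨mul_mem (Unitary.mem_iff.2 ?_) (Unitary.mem_iff.2 ?_), rfl⟩
    · rw [hss, hs]; exact ⟨rfl, rfl⟩
    · rw [h2, h1]; exact ⟨rfl, rfl⟩
  · rintro ⟨h1, h2⟩
    -- The second condition gives `t² = 1` and unitarity gives `t* t = 1`; hence `t* = t`, and `t`
    -- is the reflection of a projection.
    set t := y + y - 1 with ht
    have htt : t * t = 1 := by
      have := congr_arg (s * ·) h2
      simpa only [← mul_assoc, hs, one_mul] using this
    have hst : star t * t = 1 := by
      have := Unitary.star_mul_self_of_mem h1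
      rwa [star_mul, hss, mul_assoc, ← mul_assoc s s, hs, one_mul] at this
    have hstar : star t = t := by
      calc star t = star t * t * t := by rw [mul_assoc, htt, mul_one]
        _ = t := by rw [hst, one_mul]
    refine ⟨?_, ?_⟩
    · have h3 : (4 : ℝ) • (y * y - y) = t * t - 1 := by
        rw [ht, show (4 : ℝ) = ((4 : ℕ) : ℝ) by norm_num, Nat.cast_smul_eq_nsmul]
        noncomm_ring
      rw [htt, sub_self, smul_eq_zero_iff_right (by norm_num), sub_eq_zero] at h3
      exact h3
    · rw [ht, star_sub, star_add, star_one, sub_left_inj, add_self_inj] at hstar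
      exact hstar

theorem exp_smul_mem_unitary {b : A} (hb : star b = -b) (t : ℝ) :
    NormedSpace.exp (t • b) ∈ unitary A := by
  let _ : NormedAlgebra ℚ A := NormedAlgebra.restrictScalars ℚ ℝ A
  refine NormedSpace.exp_mem_unitary_of_mem_skewAdjoint ?_
  rw [skewAdjoint.mem_iff, star_smul, hb, star_trivial, smul_neg]

theorem mem_tangentSpaceAt_conjFibre {p q x v : A} (hx : x ∈ conjFibre p q) :
    v ∈ tangentSpaceAt (conjFibre p q) x ↔ ∃ b, star b = -b ∧ b * p = p * b ∧ v = x * b := by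
  have h1 := Unitary.star_mul_self_of_mem hx.1
  have h2 := Unitary.mul_star_self_of_mem hx.1
  constructor
  · intro hv
    let S : A →L[ℝ] A := starL' ℝ (A := A)
    have hS : HasFDerivAt (fun y : A => star y) S x := S.hasFDerivAt
    have d1 := hS.mul' (hasFDerivAt_id (𝕜 := ℝ) x)
    have z1 := apply_eq_zero_of_mem_tangentSpaceAt (M := conjFibre p q) (c := 1) d1 hx
      (fun y hy => Unitary.star_mul_self_of_mem hy.1) hv
    have e1 : star x * v + star v * x = 0 := by simpa [S] using z1
    -- On unitaries the fibre equation is equivalent to `y p = q y`, which is linear in `y`.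
    have d2 := ((hasFDerivAt_id (𝕜 := ℝ) x).mul_const' p).sub
      ((hasFDerivAt_id (𝕜 := ℝ) x).const_mul q)
    have z2 := apply_eq_zero_of_mem_tangentSpaceAt (M := conjFibre p q) (c := 0) d2 hx
      (fun y hy => sub_eq_zero.2 (mul_eq_mul_of_mem_conjFibre hy)) hv
    have e2 : v * p - q * v = 0 := by simpa using z2
    refine ⟨star x * v, ?_, ?_, ?_⟩
    · rw [star_mul, star_star]
      exact (neg_eq_of_add_eq_zero_right e1).symm
    · have h : star x * q = p * star x := by
        rw [← hx.2, ← mul_assoc, h1, one_mul]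
      rw [mul_assoc, sub_eq_zero.1 e2, ← mul_assoc, h, mul_assoc]
    · rw [← mul_assoc, h2, one_mul]
  · rintro ⟨b, hb, hbp, rfl⟩
    have hd := (hasDerivAt_exp_smul_zero b).const_mul x
    have := mem_tangentSpaceAt_of_hasDerivAt hd (M := conjFibre p q) fun t =>
      mul_mem_conjFibre hx (exp_smul_mem_unitary hb t) (exp_smul_commute hbp t)
    simpa using this

theorem mem_tangentSpaceAt_unitary {x v : A} (hx : x ∈ unitary A) :
    v ∈ tangentSpaceAt (unitary A : Set A) x ↔ ∃ b, star b = -b ∧ v = x * b := by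
  rw [← SetLike.mem_coe, ← conjFibre_one] at hx
  rw [← conjFibre_one, mem_tangentSpaceAt_conjFibre hx]
  simp

theorem mem_tangentSpaceAt_tangentBundleSet_conjFibre {p q x a b : A} (hx : x ∈ conjFibre p q)
    (ha : star a = -a) (hap : a * p = p * a) (hb : star b = -b) (hbp : b * p = p * b) :
    (x * b, (1 / 2 : ℝ) • (x * (b * a + a * b))) ∈
      tangentSpaceAt (tangentBundleSet (conjFibre p q)) (x, x * a) := by
  -- The curve `(x exp(tb), x exp(tb) (a + t k))` lies in the tangent bundle and its second
  -- component has velocity `x (b a + k)` at `0`. This `k` makes that velocity symmetric in `a` and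
  -- `b`; it is again skew and commutes with `p`.
  set k : A := (1 / 2 : ℝ) • (a * b - b * a) with hk
  have hks : star k = -k := by
    rw [hk, star_smul, star_sub, star_mul, star_mul, ha, hb, star_trivial, ← smul_neg]
    congr 1
    noncomm_ring
  have hkp : k * p = p * k := by
    rw [hk, smul_mul_assoc, mul_smul_comm]
    congr 1
    rw [sub_mul, mul_sub, mul_assoc, hbp, ← mul_assoc, hap, mul_assoc, mul_assoc b, hap,
      ← mul_assoc b, hbp, mul_assoc]
  have hg := (hasDerivAt_exp_smul_zero b).const_mul x
  have hl : HasDerivAt (fun t : ℝ => a + t • k) k 0 := by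
    simpa using ((hasDerivAt_id (0 : ℝ)).smul_const k).const_add a
  have hd := hg.prodMk (hg.mul hl)
  have hM : ∀ t : ℝ, (x * NormedSpace.exp (t • b), x * NormedSpace.exp (t • b) * (a + t • k)) ∈
      tangentBundleSet (conjFibre p q) := fun t => by
    have hy := mul_mem_conjFibre hx (exp_smul_mem_unitary hb t) (exp_smul_commute hbp t)
    refine ⟨hy, (mem_tangentSpaceAt_conjFibre hy).2 ⟨a + t • k, ?_, ?_, rfl⟩⟩
    · rw [star_add, star_smul, hks, ha, star_trivial, smul_neg, neg_add]
    · rw [add_mul, mul_add, smul_mul_assoc, mul_smul_comm, hkp, hap]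
  have hmem := mem_tangentSpaceAt_of_hasDerivAt hd hM
  simp only [Pi.mul_apply, zero_smul, NormedSpace.exp_zero, mul_one, add_zero] at hmem
  convert hmem using 2
  rw [mul_assoc, ← mul_add, ← mul_smul_comm, hk]
  congr 1
  have h : b * a = (1 / 2 : ℝ) • (b * a + b * a) := by
    rw [← two_smul ℝ, smul_smul]; norm_num
  nth_rw 2 [h]
  rw [← smul_add]
  congr 1
  abel

theorem mem_tangentSpaceAt_isStarProjection {q v : A} (hq : IsStarProjection q) :
    v ∈ tangentSpaceAt {p : A | IsStarProjection p} q ↔ ∃ c, star c = -c ∧ v = c * q - q * c := by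
  have hqq : q * q = q := hq.isIdempotentElem
  have hqs : star q = q := hq.isSelfAdjoint
  constructor
  · intro hv
    let S : A →L[ℝ] A := starL' ℝ (A := A)
    have hS : HasFDerivAt (fun y : A => star y) S q := S.hasFDerivAt
    have hid := hasFDerivAt_id (𝕜 := ℝ) q
    have z1 := apply_eq_zero_of_mem_tangentSpaceAt (M := {p : A | IsStarProjection p}) (c := 0)
      (hS.sub hid) hq (fun y hy => sub_eq_zero.2 hy.isSelfAdjoint) hv
    have e1 : star v = v := sub_eq_zero.1 (by simpa [S] using z1)
    have z2 := apply_eq_zero_of_mem_tangentSpaceAt (M := {p : A | IsStarProjection p}) (c := 0)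
      ((hid.mul' hid).sub hid) hq (fun y hy => sub_eq_zero.2 hy.isIdempotentElem) hv
    have e2 : q * v + v * q = v := sub_eq_zero.1 (by simpa using z2)
    have e3 : q * v * q = 0 := by
      have h := congr_arg (fun z => q * z * q) e2
      simp only [mul_add, add_mul] at h
      rw [← mul_assoc q q, hqq, mul_assoc q (v * q), mul_assoc v, hqq, ← mul_assoc] at h
      simpa using h
    -- A tangent vector is off-diagonal, `q v q = 0` and `q v + v q = v`, so commuting with `q`
    -- twice returns it.
    refine ⟨v * q - q * v, ?_, ?_⟩
    · rw [star_sub, star_mul, star_mul, e1, hqs, neg_sub]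
    · have h : (v * q - q * v) * q - q * (v * q - q * v) =
          v * (q * q) + q * q * v - 2 • (q * v * q) := by noncomm_ring
      rw [h, hqq, e3, smul_zero, sub_zero, add_comm, e2]
  · rintro ⟨c, hc, rfl⟩
    have hg := hasDerivAt_exp_smul_zero c
    have hd := (hg.mul_const q).mul hg.star
    have hM : ∀ t : ℝ, NormedSpace.exp (t • c) * q * star (NormedSpace.exp (t • c)) ∈
        {p : A | IsStarProjection p} := fun t => by
      refine ⟨?_, ?_⟩
      · have h := Unitary.star_mul_self_of_mem (exp_smul_mem_unitary hc t)
        set g := NormedSpace.exp (t • c)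
        change g * q * star g * (g * q * star g) = g * q * star g
        calc g * q * star g * (g * q * star g) = g * q * (star g * g) * q * star g := by
              noncomm_ring
          _ = g * q * star g := by rw [h, mul_one, mul_assoc g, hqq]
      · change star _ = _
        rw [star_mul, star_mul, star_star, hqs, mul_assoc]
    have := mem_tangentSpaceAt_of_hasDerivAt hd hM
    simpa [hc, sub_eq_add_neg] using this

end StarAlgebra

/-! ### Geodesics of the unitary group -/

section Geodesics

variable {A : Type*} [NormedRing A] [NormedAlgebra ℝ A] [StarRing A] [StarModule ℝ A]
  [ContinuousStar A] [CompleteSpace A]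

theorem eventually_mem_conjFibre_of_geodesic {p q : A} {γ : ℝ → A} {J : Set ℝ}
    (h0 : 0 ∈ J) (hJ : IsOpen J) (hγ : Set.MapsTo γ J (unitary A : Set A))
    (hsmooth : ContDiffOn ℝ ∞ γ J)
    (hgeod : ∀ t ∈ J, deriv (deriv γ) t = -((1 / 2 : ℝ) •
      (deriv γ t * star (deriv γ t) * γ t + γ t * star (deriv γ t) * deriv γ t)))
    (hmem : γ 0 ∈ conjFibre p q) (htan : deriv γ 0 ∈ tangentSpaceAt (conjFibre p q) (γ 0)) :
    ∀ᶠ t in 𝓝 (0 : ℝ), γ t ∈ conjFibre p q := by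
  obtain ⟨r, hr, hball⟩ := Metric.isOpen_iff.1 hJ 0 h0
  have hd : ∀ t ∈ J, HasDerivAt γ (deriv γ t) t := fun t ht =>
    ((hsmooth.differentiableOn (by simp)).differentiableAt (hJ.mem_nhds ht)).hasDerivAt
  have hu : ∀ t ∈ J, star (γ t) * γ t = 1 := fun t ht => Unitary.star_mul_self_of_mem (hγ ht)
  have hu' : ∀ t ∈ J, γ t * star (γ t) = 1 := fun t ht => Unitary.mul_star_self_of_mem (hγ ht)
  have hskew : ∀ t ∈ J, star (deriv γ t) * γ t = -(star (γ t) * deriv γ t) := fun t ht => by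
    have h1 := (hd t ht).star.mul (hd t ht)
    have h2 : HasDerivAt ((fun s => star (γ s)) * γ) 0 t :=
      (hasDerivAt_const t (1 : A)).congr_of_eventuallyEq <|
        Filter.eventually_of_mem (hJ.mem_nhds ht) hu
    exact eq_neg_of_add_eq_zero_left (h1.unique h2)
  -- By skewness of `γ* γ'`, the two terms of the geodesic equation coincide.
  have hd2 : ∀ t ∈ J, HasDerivAt (deriv γ) (-(deriv γ t * star (deriv γ t) * γ t)) t :=
    fun t ht => by
      have e1 : deriv γ t * star (deriv γ t) * γ t = -(deriv γ t * star (γ t) * deriv γ t) := by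
        rw [mul_assoc, hskew t ht, mul_neg, mul_assoc]
      have e2 : γ t * star (deriv γ t) * deriv γ t = -(deriv γ t * star (γ t) * deriv γ t) := by
        calc γ t * star (deriv γ t) * deriv γ t
            = γ t * (star (deriv γ t) * γ t) * (star (γ t) * deriv γ t) := by
              rw [mul_assoc, mul_assoc, mul_assoc, ← mul_assoc (γ t) (star (γ t)), hu' t ht,
                one_mul]
          _ = -(γ t * star (γ t) * deriv γ t * star (γ t) * deriv γ t) := by
              rw [hskew t ht]; noncomm_ring
          _ = -(deriv γ t * star (γ t) * deriv γ t) := by rw [hu' t ht, one_mul]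
      have e : -(deriv γ t * star (deriv γ t) * γ t) = deriv (deriv γ) t := by
        rw [hgeod t ht, e2, ← e1, ← two_smul ℝ, smul_smul]
        norm_num
      rw [e]
      exact (((hsmooth.deriv_of_isOpen hJ (m := 1) (by norm_cast)).differentiableOn
        (by simp)).differentiableAt (hJ.mem_nhds ht)).hasDerivAt
  -- The conserved velocity, translated to the identity. `J` need not be connected, so constancy is
  -- asserted only on a ball around `0`.
  let a : ℝ → A := fun t => star (γ t) * deriv γ t
  have hγa : ∀ t ∈ J, deriv γ t = γ t * a t := fun t ht => by
    rw [← mul_assoc, hu' t ht, one_mul]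
  have ha : ∀ t ∈ J, HasDerivAt a 0 t := fun t ht => by
    refine ((hd t ht).star.mul (hd2 t ht)).congr_deriv ?_
    have h := hskew t ht
    have h1 : star (γ t) * -(deriv γ t * star (deriv γ t) * γ t) =
        -((star (γ t) * deriv γ t) * (star (deriv γ t) * γ t)) := by noncomm_ring
    have h2 : star (deriv γ t) * deriv γ t =
        (star (deriv γ t) * γ t) * (star (γ t) * deriv γ t) := by
      rw [mul_assoc, ← mul_assoc (γ t), hu' t ht, one_mul]
    rw [h1, h2, h]
    noncomm_ring
  have hB : IsPreconnected (Metric.ball (0 : ℝ) r) := (convex_ball 0 r).isPreconnected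
  have h0B : (0 : ℝ) ∈ Metric.ball (0 : ℝ) r := Metric.mem_ball_self hr
  have hconst : ∀ t ∈ Metric.ball (0 : ℝ) r, a t = a 0 := fun t ht =>
    Metric.isOpen_ball.is_const_of_deriv_eq_zero hB
      (fun s hs => (ha s (hball hs)).differentiableAt.differentiableWithinAt)
      (fun s hs => (ha s (hball hs)).deriv) ht h0B
  obtain ⟨b, hb, hbp, hγb⟩ := (mem_tangentSpaceAt_conjFibre hmem).1 htan
  have ha0 : a 0 = b := by
    change star (γ 0) * deriv γ 0 = b
    rw [hγb, ← mul_assoc, hu 0 h0, one_mul]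
  have hf : ∀ t ∈ Metric.ball (0 : ℝ) r, HasDerivAt (fun s => γ s * p * star (γ s)) 0 t :=
    fun t ht => by
      have h := hd t (hball ht)
      refine ((h.mul_const p).mul h.star).congr_deriv ?_
      rw [hγa t (hball ht), hconst t ht, ha0, star_mul, hb]
      have e : γ t * b * p * star (γ t) + γ t * p * (-b * star (γ t)) =
        γ t * (b * p - p * b) * star (γ t) := by noncomm_ring
      rw [e, hbp, sub_self, mul_zero, zero_mul]
  refine Filter.eventually_of_mem (Metric.ball_mem_nhds 0 hr) fun t ht => ⟨hγ (hball ht), ?_⟩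
  rw [← hmem.2, ← mul_assoc, ← mul_assoc]
  exact Metric.isOpen_ball.is_const_of_deriv_eq_zero hB
    (fun s hs => (hf s hs).differentiableAt.differentiableWithinAt)
    (fun s hs => (hf s hs).deriv) ht h0B

end Geodesics

/-! ### Totally geodesic fibres in the orthogonal group -/

section Hilbert

variable {E : Type*} [NormedAddCommGroup E] [InnerProductSpace ℝ E] [CompleteSpace E]

theorem grassmannian_eq : grassmannian E = {p : E →L[ℝ] E | IsStarProjection p} := by
  ext p
  rw [Set.mem_ofPred_eq, isStarProjection_iff_eq_starProjection]
  rfl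

theorem PhiFibre_eq (H : Submodule ℝ E) [H.HasOrthogonalProjection] (p : E →L[ℝ] E) :
    PhiFibre H p = conjFibre H.starProjection p := rfl

theorem isSubmanifold_orthogonalGroup : IsSubmanifold (orthogonalGroup E) := by
  have h := isSubmanifold_conjFibre (A := E →L[ℝ] E) (p := 1) (.one _) 1
  rwa [conjFibre_one] at h

theorem canonicalConnection_apply (ξ α β : E →L[ℝ] E) :
    canonicalConnection ξ α β = -((1 / 2 : ℝ) • (β * star α * ξ + ξ * star α * β)) := by
  have hid := hasFDerivAt_id (𝕜 := ℝ) ξ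
  have h := (((hid.mul_const' (star α)).mul' hid).const_sub α).const_smul (1 / 2 : ℝ)
  have h' : HasFDerivAt (fun ζ : E →L[ℝ] E => tangentProj ζ α) _ ξ :=
    h.congr_of_eventuallyEq (.of_forall fun ζ => rfl)
  rw [canonicalConnection, h'.fderiv]
  simp [add_comm]

theorem isTotallyGeodesic_PhiFibre (H : Submodule ℝ E) [H.HasOrthogonalProjection]
    (p : E →L[ℝ] E) :
    IsTotallyGeodesic canonicalConnection (orthogonalGroup E) (PhiFibre H p) where
  ambient := isSubmanifold_orthogonalGroup
  submanifold := isSubmanifold_conjFibre isStarProjection_starProjection p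
  subset _ hx := hx.1
  restricts := by
    rw [PhiFibre_eq]
    intro x hx w hw u hu
    obtain ⟨a, ha, hap, rfl⟩ := (mem_tangentSpaceAt_conjFibre hx).1 hw
    obtain ⟨b, hb, hbp, rfl⟩ := (mem_tangentSpaceAt_conjFibre hx).1 hu
    convert mem_tangentSpaceAt_tangentBundleSet_conjFibre hx ha hap hb hbp using 2
    have h := Unitary.star_mul_self_of_mem hx.1
    have e : x * b * (-a * star x) * x + x * (-a * star x) * (x * b) =
        -(x * (b * a * (star x * x) + a * (star x * x) * b)) := by noncomm_ring
    rw [canonicalConnection_apply, star_mul, ha, e, h, mul_one, mul_one, smul_neg, neg_neg]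
  geodesic := by
    rintro γ J h0 ⟨hJ, hmaps, hsmooth, hgeod⟩ hmem htan
    exact eventually_mem_conjFibre_of_geodesic h0 hJ hmaps hsmooth
      (fun t ht => by rw [hgeod t ht, canonicalConnection_apply]) hmem htan

end Hilbert

/-! ### The Hilbert–Schmidt inner product -/

section HilbertSchmidt

variable {E : Type*} [NormedAddCommGroup E] [InnerProductSpace ℝ E]

theorem trace_mul_comm' (ξ η : E →L[ℝ] E) :
    LinearMap.trace ℝ E (ξ * η : E →L[ℝ] E).toLinearMap =
      LinearMap.trace ℝ E (η * ξ : E →L[ℝ] E).toLinearMap :=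
  LinearMap.trace_mul_comm ℝ ξ.toLinearMap η.toLinearMap

variable [FiniteDimensional ℝ E]

theorem hsInner_add_left (ξ₁ ξ₂ η : E →L[ℝ] E) :
    hsInner (ξ₁ + ξ₂) η = hsInner ξ₁ η + hsInner ξ₂ η := by
  simp [hsInner, inner_add_left, Finset.sum_add_distrib]

theorem eq_zero_of_hsInner_self {ξ : E →L[ℝ] E} (h : hsInner ξ ξ = 0) : ξ = 0 := by
  rw [hsInner, Finset.sum_eq_zero_iff_of_nonneg fun _ _ => real_inner_self_nonneg] at h
  have h' : ξ.toLinearMap = 0 := (stdOrthonormalBasis ℝ E).toBasis.ext fun i => by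
    simpa using h i (Finset.mem_univ i)
  ext x
  exact LinearMap.congr_fun h' x

end HilbertSchmidt

/-! ### The differential of `Phi` and the Riemannian submersion -/

section Submersion

variable {E : Type*} [NormedAddCommGroup E] [InnerProductSpace ℝ E] [CompleteSpace E]
  (H : Submodule ℝ E) [H.HasOrthogonalProjection]

theorem contDiff_Phi : ContDiff ℝ ∞ (Phi H) := by
  have h : ContDiff ℝ ∞ fun ξ : E →L[ℝ] E => star ξ :=
    (starL' ℝ (A := E →L[ℝ] E)).contDiff
  exact contDiff_id.mul (contDiff_const.mul h)

theorem fderiv_Phi_apply (ξ v : E →L[ℝ] E) :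
    fderiv ℝ (Phi H) ξ v =
      v * (H.starProjection * star ξ) + ξ * (H.starProjection * star v) := by
  let S : (E →L[ℝ] E) →L[ℝ] (E →L[ℝ] E) := starL' ℝ (A := E →L[ℝ] E)
  have hS : HasFDerivAt (fun y : E →L[ℝ] E => star y) S ξ := S.hasFDerivAt
  have h := (hasFDerivAt_id (𝕜 := ℝ) ξ).mul' (hS.const_mul H.starProjection)
  have h' : HasFDerivAt (Phi H) _ ξ := h
  rw [h'.fderiv]
  simp [S, add_comm]

theorem mapsTo_Phi : Set.MapsTo (Phi H) (orthogonalGroup E) (grassmannian E) := by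
  intro ξ hξ
  have h := Unitary.star_mul_self_of_mem hξ
  have hp : IsStarProjection H.starProjection := isStarProjection_starProjection
  rw [grassmannian_eq]
  refine ⟨?_, ?_⟩
  · change ξ * (H.starProjection * star ξ) * (ξ * (H.starProjection * star ξ)) =
      ξ * (H.starProjection * star ξ)
    calc ξ * (H.starProjection * star ξ) * (ξ * (H.starProjection * star ξ))
        = ξ * (H.starProjection * (star ξ * ξ) * H.starProjection) * star ξ := by
          simp only [mul_assoc]
      _ = ξ * (H.starProjection * star ξ) := by
          rw [h, mul_one, hp.isIdempotentElem.eq, mul_assoc]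
  · change star (ξ * (H.starProjection * star ξ)) = ξ * (H.starProjection * star ξ)
    rw [star_mul, star_mul, star_star, hp.isSelfAdjoint.star_eq, mul_assoc]

variable {H} in
theorem fderivWithin_Phi_mul {ξ b : E →L[ℝ] E} (hξ : ξ ∈ orthogonalGroup E)
    (hb : star b = -b) :
    fderivWithin ℝ (Phi H) (orthogonalGroup E) ξ (ξ * b) =
      ξ * (b * H.starProjection - H.starProjection * b) * star ξ := by
  have hd := ((contDiff_Phi H).differentiable (by simp)) ξ
  -- Derivatives within the orthogonal group are determined only on tangent vectors, where they
  -- agree with the full derivative.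
  have h := eqOn_tangentSpaceAt
    (hd.differentiableWithinAt (s := orthogonalGroup E)).hasFDerivWithinAt
    hd.hasFDerivAt.hasFDerivWithinAt ((mem_tangentSpaceAt_unitary hξ).2 ⟨b, hb, rfl⟩)
  rw [h, fderiv_Phi_apply, star_mul, hb]
  noncomm_ring

variable {H} in
theorem map_fderivWithin_Phi {ξ : E →L[ℝ] E} (hξ : ξ ∈ orthogonalGroup E) :
    (tangentSpaceAt (orthogonalGroup E) ξ).map
      (fderivWithin ℝ (Phi H) (orthogonalGroup E) ξ : (E →L[ℝ] E) →ₗ[ℝ] (E →L[ℝ] E)) =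
      tangentSpaceAt (grassmannian E) (Phi H ξ) := by
  have h1 := Unitary.star_mul_self_of_mem hξ
  have hq : IsStarProjection (Phi H ξ) := by
    have := mapsTo_Phi H hξ
    rwa [grassmannian_eq] at this
  have hconj : ∀ b, ξ * (b * H.starProjection - H.starProjection * b) * star ξ =
      ξ * b * star ξ * Phi H ξ - Phi H ξ * (ξ * b * star ξ) := fun b => by
    change _ = ξ * b * star ξ * (ξ * (H.starProjection * star ξ)) -
      ξ * (H.starProjection * star ξ) * (ξ * b * star ξ)
    have e : ξ * b * star ξ * (ξ * (H.starProjection * star ξ)) -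
        ξ * (H.starProjection * star ξ) * (ξ * b * star ξ) =
        ξ * (b * (star ξ * ξ) * H.starProjection -
          H.starProjection * (star ξ * ξ) * b) * star ξ := by noncomm_ring
    rw [e, h1, mul_one, mul_one]
  ext w
  rw [grassmannian_eq, mem_tangentSpaceAt_isStarProjection hq]
  constructor
  · rintro ⟨v, hv, rfl⟩
    obtain ⟨b, hb, rfl⟩ := (mem_tangentSpaceAt_unitary hξ).1 hv
    refine ⟨ξ * b * star ξ, ?_, ?_⟩
    · rw [star_mul, star_mul, star_star, hb]; noncomm_ring
    · exact (fderivWithin_Phi_mul hξ hb).trans (hconj b)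
  · rintro ⟨c, hc, rfl⟩
    have hb : star (star ξ * c * ξ) = -(star ξ * c * ξ) := by
      rw [star_mul, star_mul, star_star, hc]; noncomm_ring
    -- The lift of `[c, Φ(ξ)]` is `c ξ`, written as `ξ` times a skew element.
    refine ⟨ξ * (star ξ * c * ξ), (mem_tangentSpaceAt_unitary hξ).2 ⟨_, hb, rfl⟩, ?_⟩
    refine ((fderivWithin_Phi_mul hξ hb).trans (hconj _)).trans ?_
    have h2 := Unitary.mul_star_self_of_mem hξ
    have e : ξ * (star ξ * c * ξ) * star ξ = c := by
      calc ξ * (star ξ * c * ξ) * star ξ = ξ * star ξ * c * (ξ * star ξ) := by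
            simp only [mul_assoc]
        _ = c := by rw [h2, one_mul, mul_one]
    rw [e]

variable {H} in
theorem commutator_eq_mul_reflection {a : E →L[ℝ] E}
    (ha : (H.starProjection + H.starProjection - 1) * a *
      (H.starProjection + H.starProjection - 1) = -a) :
    a * H.starProjection - H.starProjection * a =
      a * (H.starProjection + H.starProjection - 1) := by
  have hp : IsStarProjection H.starProjection := isStarProjection_starProjection
  have hs := reflection_mul_self hp.isIdempotentElem.eq
  have h : (H.starProjection + H.starProjection - 1) * a =
      -(a * (H.starProjection + H.starProjection - 1)) := by
    have := congr_arg (· * (H.starProjection + H.starProjection - 1)) ha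
    simpa only [mul_assoc, hs, mul_one, neg_mul] using this
  rw [← add_self_inj]
  calc a * H.starProjection - H.starProjection * a + (a * H.starProjection - H.starProjection * a)
      = a * (H.starProjection + H.starProjection - 1) -
        (H.starProjection + H.starProjection - 1) * a := by noncomm_ring
    _ = _ := by rw [h, sub_neg_eq_add]

section FiniteDimensional

variable [FiniteDimensional ℝ E]

/-- In trace form, right invariance under orthogonal factors follows from cyclicity. -/
theorem hsInner_eq_trace (ξ η : E →L[ℝ] E) :
    hsInner ξ η = LinearMap.trace ℝ E (star ξ * η : E →L[ℝ] E).toLinearMap := by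
  rw [LinearMap.trace_eq_sum_inner _ (stdOrthonormalBasis ℝ E)]
  simp [hsInner, ContinuousLinearMap.star_eq_adjoint, ContinuousLinearMap.adjoint_inner_right]

theorem hsInner_mul_left {u : E →L[ℝ] E} (hu : star u * u = 1) (ξ η : E →L[ℝ] E) :
    hsInner (u * ξ) (u * η) = hsInner ξ η := by
  rw [hsInner_eq_trace, hsInner_eq_trace, star_mul, mul_assoc, ← mul_assoc (star u), hu, one_mul]

theorem hsInner_mul_right {u : E →L[ℝ] E} (hu : u * star u = 1) (ξ η : E →L[ℝ] E) :
    hsInner (ξ * u) (η * u) = hsInner ξ η := by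
  rw [hsInner_eq_trace, hsInner_eq_trace, star_mul, mul_assoc, trace_mul_comm', mul_assoc,
    mul_assoc, hu, mul_one]

variable {H} in
-- Twice the vertical part of `a` is `k = a + s a s`: it commutes with `s`, so `ξ k` lies in the
-- kernel and `a ⊥ k`. Conjugation by `s` is an isometry fixing `k`, so also `s a s ⊥ k`; adding
-- gives `k ⊥ k`.
theorem reflection_conj_eq_neg_of_horizontal {ξ a : E →L[ℝ] E} (hξ : ξ ∈ orthogonalGroup E)
    (ha : star a = -a)
    (hhor : ∀ w ∈ tangentSpaceAt (orthogonalGroup E) ξ,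
      fderivWithin ℝ (Phi H) (orthogonalGroup E) ξ w = 0 → hsInner (ξ * a) w = 0) :
    (H.starProjection + H.starProjection - 1) * a * (H.starProjection + H.starProjection - 1) =
      -a := by
  have hp : IsStarProjection H.starProjection := isStarProjection_starProjection
  have hs := reflection_mul_self hp.isIdempotentElem.eq
  have hss : star (H.starProjection + H.starProjection - 1) =
      H.starProjection + H.starProjection - 1 := by simp [hp.isSelfAdjoint.star_eq]
  have hcomm := reflection_conj_eq_self_iff (g := a + (H.starProjection + H.starProjection - 1) *
    a * (H.starProjection + H.starProjection - 1)) hp.isIdempotentElem.eq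
  set s := H.starProjection + H.starProjection - 1
  set k := a + s * a * s with hk
  have hks : s * k * s = k := by
    have e : s * k * s = s * a * s + s * s * a * (s * s) := by rw [hk]; noncomm_ring
    rw [e, hs, one_mul, mul_one, add_comm]
  have hkstar : star k = -k := by
    rw [hk, star_add, star_mul, star_mul, ha, hss]; noncomm_ring
  have h0 : hsInner a k = 0 := by
    rw [← hsInner_mul_left (Unitary.star_mul_self_of_mem hξ)]
    refine hhor _ ((mem_tangentSpaceAt_unitary hξ).2 ⟨k, hkstar, rfl⟩) ?_
    rw [fderivWithin_Phi_mul hξ hkstar, hcomm.1 hks, sub_self, mul_zero, zero_mul]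
  have h1 : hsInner (s * a * s) k = 0 := by
    rw [← hks, hsInner_mul_right (by rw [hss, hs]), hsInner_mul_left (by rw [hss, hs]), h0]
  have h2 : k = 0 := eq_zero_of_hsInner_self (by
    nth_rw 1 [hk]
    rw [hsInner_add_left, h0, h1, add_zero])
  exact eq_neg_of_add_eq_zero_right h2

theorem isRiemannianSubmersion_Phi :
    IsRiemannianSubmersion hsInner hsInner (orthogonalGroup E) (grassmannian E) (Phi H) where
  source := isSubmanifold_orthogonalGroup
  target := by
    rw [grassmannian_eq]
    exact isSubmanifold_setOf_isStarProjection
  mapsTo := mapsTo_Phi H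
  smooth := (contDiff_Phi H).contDiffOn
  surjective _ hξ := map_fderivWithin_Phi hξ
  isometric := by
    intro ξ hξ u hu v hv hu' hv'
    obtain ⟨a, ha, rfl⟩ := (mem_tangentSpaceAt_unitary hξ).1 hu
    obtain ⟨b, hb, rfl⟩ := (mem_tangentSpaceAt_unitary hξ).1 hv
    have hp : IsStarProjection H.starProjection := isStarProjection_starProjection
    have hs := reflection_mul_self hp.isIdempotentElem.eq
    have hss : star (H.starProjection + H.starProjection - 1) =
        H.starProjection + H.starProjection - 1 := by simp [hp.isSelfAdjoint.star_eq]
    have h1 := Unitary.star_mul_self_of_mem hξ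
    -- The images become `ξ a s ξ*` and `ξ b s ξ*`; the orthogonal factors are then cancelled one at
    -- a time.
    rw [fderivWithin_Phi_mul hξ ha, fderivWithin_Phi_mul hξ hb,
      commutator_eq_mul_reflection (reflection_conj_eq_neg_of_horizontal hξ ha hu'),
      commutator_eq_mul_reflection (reflection_conj_eq_neg_of_horizontal hξ hb hv'),
      hsInner_mul_right (by rw [star_star, h1]), hsInner_mul_left h1,
      hsInner_mul_right (by rw [hss, hs]), hsInner_mul_left h1]

end FiniteDimensional

end Submersion

end GrassmannGeometry

open GrassmannGeometry
theorem mainTheorem8 {E : Type*} [NormedAddCommGroup E] [InnerProductSpace ℝ E] [CompleteSpace E]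
    (H : Submodule ℝ E) [H.HasOrthogonalProjection] :
    Set.MapsTo (Phi H) (orthogonalGroup E) (grassmannian E) ∧
    (∀ p ∈ grassmannian E,
      IsTotallyGeodesic canonicalConnection (orthogonalGroup E) (PhiFibre H p)) ∧
    (∀ [FiniteDimensional ℝ E],
      IsRiemannianSubmersion hsInner hsInner (orthogonalGroup E) (grassmannian E) (Phi H)) :=
  ⟨mapsTo_Phi H, fun p _ => isTotallyGeodesic_PhiFibre H p, isRiemannianSubmersion_Phi H⟩
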